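/- Let $\mathbb T$ be one of $\mathbb R$, $[0,\infty)$, $(0,\infty)$, and let $f,g:(0,\infty)\to(0,\infty)$ be continuous. Let $(X_t)_{t\in\mathbb T}$ be a real-valued stochastic process on a probability space, all of whose finite-dimensional distributions are infinitely divisible; for $t_1,\dots,t_k\in\mathbb T$ let $\psi_{t_1,\dots,t_k}:\mathbb R^k\to\mathbb C$ be the characteristic exponent of $(X_{t_1},\dots,X_{t_k})$, i.e. the unique continuous function with $\psi_{t_1,\dots,t_k}(0)=0$ and $\mathbb E\,e^{i\sum_j\theta_jX_{t_j}}=e^{-\psi_{t_1,\dots,t_k}(\theta_1,\dots,\theta_k)}$ for all $\theta\in\mathbb R^k$. The process $X$ is called $(f,g)$-dilatively stable if $$\psi_{Tt_1,\dots,Tt_k}(\theta_1,\dots,\theta_k)=g(T)\,\psi_{t_1,\dots,t_k}(f(T)\theta_1,\dots,f(T)\theta_k)$$ for all $T>0$, $k\in\mathbb N$, $\theta_1,\dots,\theta_k\in\mathbb R$, $t_1,\dots,t_k\in\mathbb T$. **Theorem 1.6.** Let $X=(X_t)_{t\in\mathbb T}$ be an $(f,g)$-dilatively stable process. (i) If $X$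 is not the identically zero process (that is, $\mathbb P(X_t\neq0)>0$ for some $t\in\mathbb T$) and, for some $\beta\in\mathbb R$, $f(T)=T^\beta$ for all $T>0$, then there is a unique $\gamma\in\mathbb R$ such that $g(T)=T^\gamma$ for all $T>0$. Moreover, $\gamma$ is the only $\gamma'\in\mathbb R$ for which $X$ is $(T^\beta,T^{\gamma'})$-dilatively stable. In each of the cases (ii), (iii), (iv) below there are unique $\beta,\gamma\in\mathbb R$ such that $f(T)=T^\beta$ and $g(T)=T^\gamma$ for all $T>0$. Moreover, $(\beta,\gamma)$ is the only pair $(\beta',\gamma')\in\mathbb R^2$ for which $X$ is $(T^{\beta'},T^{\gamma'})$-dilatively stable. (ii) $X_1$ is not Gaussian, but has a nonzero Gaussian component in its Lévy–Khintchine representation, i.e. $\sigma>0$ in $$\mathbb E\,e^{i\theta X_1}=\exp\Bigl(-\Bigl(ia\theta+\tfrac12\sigma^2\theta^2+\int_{\mathbb R\setminus\{0\}}\Bigl(1-e^{i\theta x}+\frac{i\theta x}{1+x^2}\Bigr)\mu(dx)\Bigr)\Bigr),\qquad\theta\in\mathbb R,$$ where $a\in\mathbb R$, $\sigma\ge0$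 and $\mu$ is a measure on $\mathbb R\setminus\{0\}$ with $\int\min(1,x^2)\,\mu(dx)<\infty$. (iii) $\mathbb E(X_1^2)<\infty$, $\mathbb E(X_1)\neq0$ and $\operatorname{Var}(X_1)>0$. (iv) $X_1$ is not Gaussian, $\mathbb E(X_1^2)<\infty$ and $\operatorname{Var}(X_1)>0$. -/

import Mathlib

open MeasureTheory ProbabilityTheory
open scoped ENNReal RealInnerProductSpace

namespace DilativeStability

noncomputable section

section Laws

variable {E : Type*} [NormedAddCommGroup E] [InnerProductSpace ℝ E] [MeasurableSpace E]

/-- A law `μ` is infinitely divisible if for every `n ≥ 1` it is the law of the sum of `n`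
independent random elements with a common distribution `ν`. -/
def InfinitelyDivisible (μ : Measure E) : Prop :=
  ∀ n : ℕ, n ≠ 0 → ∃ ν : Measure E, IsProbabilityMeasure ν ∧
    (Measure.pi (fun _ : Fin n => ν)).map (fun x => ∑ i, x i) = μ

/-- `ψ` is continuous, `ψ 0 = 0` and `exp (-ψ)` is the characteristic function of `μ`. -/
structure IsCharExponent (μ : Measure E) (ψ : E → ℂ) : Prop where
  continuous : Continuous ψ
  map_zero : ψ 0 = 0
  charFun_eq : ∀ θ, charFun μ θ = Complex.exp (-ψ θ)

open Classical in
/-- The characteristic exponent of `μ`: the unique `ψ` with `IsCharExponent μ ψ`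
(it exists for every infinitely divisible `μ`, see
`InfinitelyDivisible.isCharExponent_charExponent`, and is unique, see `IsCharExponent.unique`). -/
def charExponent (μ : Measure E) : E → ℂ :=
  if h : ∃ ψ, IsCharExponent μ ψ then h.choose else 0

theorem IsCharExponent.unique {μ : Measure E} {ψ φ : E → ℂ}
    (hψ : IsCharExponent μ ψ) (hφ : IsCharExponent μ φ) : ψ = φ := by
  have h0 : charFun μ 0 ≠ 0 := by rw [hψ.charFun_eq]; exact Complex.exp_ne_zero _
  have hc : Continuous (charFun μ) := by
    have : charFun μ = fun θ => Complex.exp (-ψ θ) := funext hψ.charFun_eq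
    rw [this]; exact Complex.continuous_exp.comp hψ.continuous.neg
  have hne : ∀ a, charFun μ a ∈ ({0}ᶜ : Set ℂ) := fun a => by
    rw [hψ.charFun_eq]; exact Complex.exp_ne_zero _
  have key := Complex.isCoveringMapOn_exp.existsUnique_continuousMap_lifts
    (A := E) ⟨charFun μ, hc⟩ (a₀ := 0) (e₀ := 0)
    (by simp [hψ.charFun_eq, hψ.map_zero]) hne
  have := key.unique (y₁ := ⟨fun a => -ψ a, hψ.continuous.neg⟩)
    (y₂ := ⟨fun a => -φ a, hφ.continuous.neg⟩)
    ⟨by simp [hψ.map_zero], by ext a; simp [hψ.charFun_eq]⟩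
    ⟨by simp [hφ.map_zero], by ext a; simp [hφ.charFun_eq]⟩
  funext a
  simpa using congrArg (fun F : C(E, ℂ) => F a) this

theorem IsCharExponent.charExponent_eq {μ : Measure E} {ψ : E → ℂ}
    (hψ : IsCharExponent μ ψ) : charExponent μ = ψ := by
  have h : ∃ ψ, IsCharExponent μ ψ := ⟨ψ, hψ⟩
  rw [charExponent, dif_pos h]
  exact h.choose_spec.unique hψ

variable [BorelSpace E] [SecondCountableTopology E]

theorem one_sub_norm_charFun_sq_le [CompleteSpace E] (ν : Measure E) [IsProbabilityMeasure ν]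
    (θ : E) :
    1 - ‖charFun ν ((2 : ℝ) • θ)‖ ^ 2 ≤ 4 * (1 - ‖charFun ν θ‖ ^ 2) := by
  have key : ∀ θ : E, ‖charFun ν θ‖ ^ 2 = ∫ p : E × E, Real.cos ⟪p.1 - p.2, θ⟫ ∂(ν.prod ν) := by
    intro θ
    have h1 : charFun ν θ * (starRingEnd ℂ) (charFun ν θ)
        = ∫ p : E × E, Complex.exp (⟪p.1 - p.2, θ⟫ * Complex.I) ∂(ν.prod ν) := by
      rw [← charFun_neg, charFun_apply, charFun_apply, ← integral_prod_mul]
      congr 1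
      ext p
      rw [← Complex.exp_add]
      congr 1
      rw [inner_sub_left, inner_neg_right]
      push_cast
      ring
    rw [Complex.mul_conj] at h1
    have hi : Integrable (fun p : E × E => Complex.exp (⟪p.1 - p.2, θ⟫ * Complex.I))
        (ν.prod ν) := by
      refine Integrable.of_bound (C := 1) ?_ ?_
      · exact (by fun_prop : Continuous
          (fun p : E × E => Complex.exp (⟪p.1 - p.2, θ⟫ * Complex.I))).aestronglyMeasurable
      · exact Filter.Eventually.of_forall fun p => (Complex.norm_exp_ofReal_mul_I _).le
    have h2 := congrArg Complex.re h1
    rw [Complex.ofReal_re, Complex.normSq_eq_norm_sq] at h2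
    rw [h2]
    have h3 := integral_re hi
    simp only [RCLike.re_eq_complex_re, Complex.exp_ofReal_mul_I_re] at h3
    exact h3.symm
  have hint : ∀ θ : E, Integrable (fun p : E × E => Real.cos ⟪p.1 - p.2, θ⟫) (ν.prod ν) := by
    intro θ
    refine Integrable.of_bound (C := 1) ?_ ?_
    · exact (by fun_prop : Continuous
        (fun p : E × E => Real.cos ⟪p.1 - p.2, θ⟫)).aestronglyMeasurable
    · exact Filter.Eventually.of_forall fun p => Real.abs_cos_le_one _
  rw [key, key]
  have e : ∀ θ : E, 1 - ∫ p : E × E, Real.cos ⟪p.1 - p.2, θ⟫ ∂(ν.prod ν)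
      = ∫ p : E × E, (1 - Real.cos ⟪p.1 - p.2, θ⟫) ∂(ν.prod ν) := by
    intro θ
    rw [integral_sub (integrable_const _) (hint θ)]
    simp
  rw [e, e, ← integral_const_mul]
  refine integral_mono ((integrable_const _).sub (hint _))
    (((integrable_const _).sub (hint _)).const_mul _) fun p => ?_
  simp only [inner_smul_right, Real.cos_two_mul]
  nlinarith [sq_nonneg (1 - Real.cos ⟪p.1 - p.2, θ⟫)]

theorem InfinitelyDivisible.isProbabilityMeasure {μ : Measure E} (h : InfinitelyDivisible μ) :
    IsProbabilityMeasure μ := by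
  obtain ⟨ν, hν, rfl⟩ := h 1 one_ne_zero
  exact Measure.isProbabilityMeasure_map (by fun_prop)

theorem InfinitelyDivisible.exists_pow [CompleteSpace E] {μ : Measure E}
    (h : InfinitelyDivisible μ) {n : ℕ} (hn : n ≠ 0) :
    ∃ ν : Measure E, IsProbabilityMeasure ν ∧ ∀ θ, charFun μ θ = charFun ν θ ^ n := by
  obtain ⟨ν, hν, rfl⟩ := h n hn
  exact ⟨ν, hν, fun θ => by rw [charFun_map_sum_pi_eq_prod]; simp⟩

theorem InfinitelyDivisible.charFun_ne_zero [CompleteSpace E] {μ : Measure E}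
    (h : InfinitelyDivisible μ) (θ : E) : charFun μ θ ≠ 0 := by
  have := h.isProbabilityMeasure
  have step : ∀ θ : E, charFun μ θ ≠ 0 → charFun μ ((2 : ℝ) • θ) ≠ 0 := by
    intro θ hθ h2
    choose ν hν hpow using fun n : ℕ => h.exists_pow (n := n + 1) (Nat.succ_ne_zero n)
    have hz : ∀ n, charFun (ν n) ((2 : ℝ) • θ) = 0 := fun n => by
      have := hpow n ((2 : ℝ) • θ)
      rw [h2] at this
      exact pow_eq_zero_iff (Nat.succ_ne_zero n) |>.1 this.symm
    have hle : ∀ n, (‖charFun (ν n) θ‖ ^ 2) ≤ 3 / 4 := fun n => by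
      have := one_sub_norm_charFun_sq_le (ν n) θ
      rw [hz n] at this
      norm_num at this
      linarith
    have hle2 : ∀ n : ℕ, ‖charFun μ θ‖ ^ 2 ≤ (3 / 4 : ℝ) ^ (n + 1) := fun n => by
      rw [hpow n θ, norm_pow, ← pow_mul, mul_comm, pow_mul]
      exact pow_le_pow_left₀ (by positivity) (hle n) _
    have hlim : Filter.Tendsto (fun n : ℕ => (3 / 4 : ℝ) ^ (n + 1)) Filter.atTop (nhds 0) :=
      (tendsto_pow_atTop_nhds_zero_of_lt_one (by norm_num) (by norm_num)).comp
        (Filter.tendsto_add_atTop_nat 1)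
    have := ge_of_tendsto' hlim hle2
    have hpos : 0 < ‖charFun μ θ‖ := norm_pos_iff.2 hθ
    nlinarith [pow_pos hpos 2]
  have iter : ∀ m : ℕ, ∀ θ : E, charFun μ θ ≠ 0 → charFun μ ((2 : ℝ) ^ m • θ) ≠ 0 := by
    intro m
    induction m with
    | zero => intro θ hθ; simpa using hθ
    | succ m ih =>
      intro θ hθ
      rw [pow_succ', mul_smul]
      exact step _ (ih θ hθ)
  have hlim : Filter.Tendsto (fun m : ℕ => charFun μ (((2 : ℝ)⁻¹) ^ m • θ)) Filter.atTop
      (nhds 1) := by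
    have h0 : charFun μ (0 : E) = 1 := by simp
    rw [← h0]
    refine (continuous_charFun (μ := μ)).continuousAt.tendsto.comp ?_
    have := (tendsto_pow_atTop_nhds_zero_of_lt_one (r := (2 : ℝ)⁻¹) (by norm_num)
      (by norm_num)).smul_const θ
    simpa using this
  obtain ⟨m, hm⟩ := (hlim.eventually_ne one_ne_zero).exists
  have := iter m _ hm
  rwa [smul_smul, ← mul_pow, mul_inv_cancel₀ two_ne_zero, one_pow, one_smul] at this

theorem InfinitelyDivisible.isCharExponent_charExponent [CompleteSpace E] {μ : Measure E}
    (h : InfinitelyDivisible μ) : IsCharExponent μ (charExponent μ) := by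
  have := h.isProbabilityMeasure
  obtain ⟨F, ⟨hF0, hF⟩, -⟩ := Complex.isCoveringMapOn_exp.existsUnique_continuousMap_lifts
    (A := E) ⟨charFun μ, continuous_charFun⟩ (a₀ := 0) (e₀ := 0)
    (by simp) (fun a => h.charFun_ne_zero a)
  have hψ : IsCharExponent μ (fun θ => -F θ) :=
    ⟨F.continuous.neg, by simp [hF0], fun θ => by simpa using (congrFun hF θ).symm⟩
  rw [hψ.charExponent_eq]
  exact hψ

end Laws

/-- `(a, σ, ν)` is a Lévy--Khintchine triplet of the law `μ` on `ℝ`: `σ ≥ 0`, `ν` is a Lévy measure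
(a measure on `ℝ ∖ {0}` that integrates `min (1, x²)`), and
`∫ exp (i θ x) μ(dx)
  = exp (-(i a θ + σ² θ² / 2 + ∫ (1 - exp (i θ x) + i θ x / (1 + x²)) ν(dx)))`. -/
structure IsLevyKhintchineTriplet (μ : Measure ℝ) (a σ : ℝ) (ν : Measure ℝ) : Prop where
  nonneg : 0 ≤ σ
  zero_notMem : ν {0} = 0
  lintegral_lt_top : ∫⁻ x, ENNReal.ofReal (min 1 (x ^ 2)) ∂ν < ∞
  charFun_eq : ∀ θ : ℝ, charFun μ θ =
    Complex.exp (-(Complex.I * a * θ + (1 / 2 : ℂ) * σ ^ 2 * θ ^ 2 +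
      ∫ x : ℝ, (1 - Complex.exp (Complex.I * θ * x) + Complex.I * θ * x / (1 + x ^ 2)) ∂ν))

/-- The law `μ` on `ℝ` has a nonzero Gaussian component in its Lévy--Khintchine representation. -/
def HasGaussianComponent (μ : Measure ℝ) : Prop :=
  ∃ (a σ : ℝ) (ν : Measure ℝ), IsLevyKhintchineTriplet μ a σ ν ∧ 0 < σ

section Processes

variable {Ω : Type*} [MeasurableSpace Ω]

/-- The law on `ℝ^k` of `(X_{t 1}, …, X_{t k})`. -/
def finDimLaw (P : Measure Ω) (X : ℝ → Ω → ℝ) {k : ℕ} (t : Fin k → ℝ) :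
    Measure (EuclideanSpace ℝ (Fin k)) :=
  P.map (fun ω => WithLp.toLp 2 (fun j => X (t j) ω))

/-- The admissible time sets: `ℝ`, `[0, ∞)` and `(0, ∞)`. -/
def IsTimeSet (𝕋 : Set ℝ) : Prop :=
  𝕋 = Set.univ ∨ 𝕋 = Set.Ici 0 ∨ 𝕋 = Set.Ioi 0

/-- `(f, g)`-dilative stability of the process `(X t)_{t ∈ 𝕋}`. Only the values of `X` on `𝕋` and
the values of `f`, `g` on `(0, ∞)` play a role. -/
structure IsDilativelyStable (P : Measure Ω) (𝕋 : Set ℝ) (X : ℝ → Ω → ℝ) (f g : ℝ → ℝ) :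
    Prop where
  measurable : ∀ t ∈ 𝕋, Measurable (X t)
  continuousOn_left : ContinuousOn f (Set.Ioi 0)
  continuousOn_right : ContinuousOn g (Set.Ioi 0)
  pos_left : ∀ T, 0 < T → 0 < f T
  pos_right : ∀ T, 0 < T → 0 < g T
  infinitelyDivisible : ∀ (k : ℕ) (t : Fin k → ℝ), (∀ j, t j ∈ 𝕋) →
    InfinitelyDivisible (finDimLaw P X t)
  scaling : ∀ T : ℝ, 0 < T → ∀ (k : ℕ) (t : Fin k → ℝ), (∀ j, t j ∈ 𝕋) →
    ∀ θ : EuclideanSpace ℝ (Fin k),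
      charExponent (finDimLaw P X (fun j => T * t j)) θ =
        (g T : ℂ) * charExponent (finDimLaw P X t) (f T • θ)

/-- The real random variable `Y` is Gaussian (possibly degenerate). -/
def IsGaussianVariable (P : Measure Ω) (Y : Ω → ℝ) : Prop :=
  ∃ (m : ℝ) (v : NNReal), P.map Y = gaussianReal m v

/-- There are `β, γ` with `f(T) = T^β` and `g(T) = T^γ` for all `T > 0`, and they are the only
exponents `β', γ'` such that `X` is `(T^β', T^γ')`-dilatively stable. As `X` is assumed to be
`(f, g)`-dilatively stable where this is used, in particular no other
`β', γ'` satisfy `f(T) = T^β'` and `g(T) = T^γ'` for all `T > 0`. -/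
def AreUniquePowers (P : Measure Ω) (𝕋 : Set ℝ) (X : ℝ → Ω → ℝ) (f g : ℝ → ℝ) : Prop :=
  ∃ β γ : ℝ, (∀ T : ℝ, 0 < T → f T = T ^ β) ∧ (∀ T : ℝ, 0 < T → g T = T ^ γ) ∧
    ∀ β' γ' : ℝ, IsDilativelyStable P 𝕋 X (fun T => T ^ β') (fun T => T ^ γ') →
      β' = β ∧ γ' = γ

end Processes

end

end DilativeStability

open DilativeStability

/-! Let `ψ` be the exponent of a single marginal. Dilating time by `S * T` in one step or in two
gives `g (S * T) ψ (f (S * T) θ) = g S g T ψ (f S f T θ)`. If `ψ = c ψ(a ·)` with `a, c > 0` forces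
`a = c = 1` (`IsScaleRigid`), then `f` and `g` are multiplicative, and continuity makes them powers.
Comparing two admissible pairs of scaling functions in the same way gives uniqueness. When `f` is
already a power, both arguments of `ψ` agree, and `ψ` need only be nonzero somewhere.

It remains to prove rigidity at time `1`. Suppose `ψ = c ψ(a ·)`. The quotient `ψ θ / θ²` tends to
`σ² / 2` at infinity by Lévy–Khintchine, or, for a centred variable with finite variance, to half
the variance at `0`. A nonzero limit forces `c a² = 1`, so the quotient is invariant under `θ ↦ a
θ`. If `a ≠ 1`, iterating towards the limit point makes it constant off `0`, and the law is centred
Gaussian. A nonzero mean is handled separately: the first order term gives `c a = 1`, and with `c a²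
= 1` this yields `a = 1`. -/

namespace DilativeStability

open Filter Topology Asymptotics

/-! ### Multiplicative functions and powers -/

section Powers

/-- A continuous positive multiplicative function on `(0, ∞)` is a power. -/
theorem exists_rpow_of_multiplicative {f : ℝ → ℝ} (hc : ContinuousOn f (Set.Ioi 0))
    (hpos : ∀ T, 0 < T → 0 < f T) (hmul : ∀ S T, 0 < S → 0 < T → f (S * T) = f S * f T) :
    ∃ β : ℝ, ∀ T, 0 < T → f T = T ^ β := by
  -- In logarithmic coordinates this is Cauchy's equation; a continuous additive map is real linear,
  -- so the exponent is `F 1`.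
  let F : ℝ →+ ℝ := AddMonoidHom.mk' (fun x => Real.log (f (Real.exp x))) fun x y => by
    rw [Real.exp_add, hmul _ _ (Real.exp_pos _) (Real.exp_pos _),
      Real.log_mul (hpos _ (Real.exp_pos _)).ne' (hpos _ (Real.exp_pos _)).ne']
  have hF : Continuous F := by
    refine Continuous.log (hc.comp_continuous Real.continuous_exp fun x => Real.exp_pos x)
      fun x => (hpos _ (Real.exp_pos _)).ne'
  refine ⟨F 1, fun T hT => ?_⟩
  have h1 : F (Real.log T) = Real.log T * F 1 := by
    have := (F.toRealLinearMap hF).map_smul (Real.log T) 1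
    simpa using this
  have h2 : F (Real.log T) = Real.log (f T) := by
    change Real.log (f (Real.exp (Real.log T))) = _
    rw [Real.exp_log hT]
  rw [Real.rpow_def_of_pos hT, ← h1, h2, Real.exp_log (hpos T hT)]

theorem rpow_exponent_unique {β γ : ℝ} (h : ∀ T : ℝ, 0 < T → T ^ β = T ^ γ) : β = γ := by
  have := congrArg Real.log (h (Real.exp 1) (Real.exp_pos 1))
  simpa [Real.log_rpow (Real.exp_pos 1)] using this

end Powers

/-! ### Exponents invariant under scaling -/

section Rigidity

/-- The only relation `ψ = c ψ(a ·)` with `a, c > 0` is the trivial one. -/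
def IsScaleRigid (ψ : ℝ → ℂ) : Prop :=
  ∀ a c : ℝ, 0 < a → 0 < c → (∀ θ, ψ θ = c * ψ (a * θ)) → a = 1 ∧ c = 1

theorem IsScaleRigid.eq_and_eq {ψ : ℝ → ℂ} (h : IsScaleRigid ψ) {a a' c c' : ℝ}
    (ha : 0 < a) (ha' : 0 < a') (hc : 0 < c) (hc' : 0 < c')
    (he : ∀ θ : ℝ, (c : ℂ) * ψ (a * θ) = c' * ψ (a' * θ)) : a = a' ∧ c = c' := by
  have hcC : (c : ℂ) ≠ 0 := by exact_mod_cast hc.ne'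
  obtain ⟨h1, h2⟩ := h (a' / a) (c' / c) (by positivity) (by positivity) fun θ => by
    have := he (θ / a)
    rw [mul_div_cancel₀ _ ha.ne', ← mul_div_assoc, mul_div_right_comm] at this
    push_cast
    rw [div_mul_eq_mul_div, eq_div_iff hcC, mul_comm, this]
  rw [div_eq_one_iff_eq ha.ne'] at h1
  rw [div_eq_one_iff_eq hc.ne'] at h2
  exact ⟨h1.symm, h2.symm⟩

theorem eq_of_scale_invariant {h : ℝ → ℂ} {b θ : ℝ} {L : ℂ} (hinv : ∀ θ, h (b * θ) = h θ)
    (hlim : Tendsto (fun n : ℕ => h (b ^ n * θ)) atTop (𝓝 L)) : h θ = L := by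
  have : ∀ n : ℕ, h (b ^ n * θ) = h θ := fun n => by
    induction n with
    | zero => simp
    | succ n ih => rw [pow_succ', mul_assoc, hinv, ih]
  simp only [this] at hlim
  exact tendsto_nhds_unique tendsto_const_nhds hlim

theorem scale_invariant_inv {h : ℝ → ℂ} {a : ℝ} (ha : 0 < a) (hinv : ∀ θ, h (a * θ) = h θ)
    (θ : ℝ) : h (a⁻¹ * θ) = h θ := by
  rw [← hinv (a⁻¹ * θ), mul_inv_cancel_left₀ ha.ne']

/-- A scale invariant function with a limit at `0` is constant off `0`. -/
theorem eq_of_scale_invariant_of_tendsto_zero {h : ℝ → ℂ} {a : ℝ} {L : ℂ} (ha : 0 < a)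
    (ha1 : a ≠ 1) (hinv : ∀ θ, h (a * θ) = h θ) (hlim : Tendsto h (𝓝[≠] 0) (𝓝 L))
    {θ : ℝ} (hθ : θ ≠ 0) : h θ = L := by
  -- Invariance under `a` and under `a⁻¹` are equivalent, so the factor may be chosen such that its
  -- powers shrink to `0`.
  have key : ∀ b : ℝ, 0 < b → b < 1 → (∀ θ, h (b * θ) = h θ) → h θ = L := by
    intro b hb hb1 hbinv
    refine eq_of_scale_invariant hbinv (hlim.comp (tendsto_nhdsWithin_iff.2 ⟨?_, ?_⟩))
    · simpa using (tendsto_pow_atTop_nhds_zero_of_lt_one hb.le hb1).mul_const θ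
    · exact Eventually.of_forall fun n => mul_ne_zero (pow_pos hb n).ne' hθ
  rcases lt_or_gt_of_ne ha1 with h1 | h1
  · exact key a ha h1 hinv
  · exact key a⁻¹ (inv_pos.2 ha) (inv_lt_one_of_one_lt₀ h1) (scale_invariant_inv ha hinv)

/-- A scale invariant function with a limit at infinity is constant off `0`. -/
theorem eq_of_scale_invariant_of_tendsto_cobounded {h : ℝ → ℂ} {a : ℝ} {L : ℂ} (ha : 0 < a)
    (ha1 : a ≠ 1) (hinv : ∀ θ, h (a * θ) = h θ) (hlim : Tendsto h (Bornology.cobounded ℝ) (𝓝 L))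
    {θ : ℝ} (hθ : θ ≠ 0) : h θ = L := by
  have key : ∀ b : ℝ, 1 < b → (∀ θ, h (b * θ) = h θ) → h θ = L := by
    intro b hb1 hbinv
    refine eq_of_scale_invariant hbinv (hlim.comp (tendsto_norm_atTop_iff_cobounded.1 ?_))
    have hb : 0 < b := by linarith
    simp only [norm_mul, norm_pow, Real.norm_of_nonneg hb.le]
    exact (tendsto_pow_atTop_atTop_of_one_lt hb1).atTop_mul_const (norm_pos_iff.2 hθ)
  rcases lt_or_gt_of_ne ha1 with h1 | h1
  · exact key a⁻¹ ((one_lt_inv₀ ha).2 h1) (scale_invariant_inv ha hinv)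
  · exact key a h1 hinv

theorem div_sq_scale_invariant {ψ : ℝ → ℂ} {a c : ℝ} (ha : 0 < a) (hca : c * a ^ 2 = 1)
    (hψ : ∀ θ, ψ θ = c * ψ (a * θ)) (θ : ℝ) :
    ψ (a * θ) / ((a * θ : ℝ) : ℂ) ^ 2 = ψ θ / (θ : ℂ) ^ 2 := by
  -- At `θ = 0` both quotients are `0`, since division by zero gives `0`; the invariance thus holds
  -- everywhere.
  rcases eq_or_ne θ 0 with rfl | hθ
  · simp
  have haC : (a : ℂ) ≠ 0 := by exact_mod_cast ha.ne'
  have hθC : (θ : ℂ) ≠ 0 := by exact_mod_cast hθ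
  have hcaC : (c : ℂ) * a ^ 2 = 1 := by exact_mod_cast hca
  rw [hψ θ]
  push_cast
  rw [div_eq_div_iff (by positivity) (by positivity)]
  linear_combination (-(θ : ℂ) ^ 2 * ψ (a * θ)) * hcaC

/-- If `ψ = c ψ(a ·)` and `ψ θ / θ²` has a nonzero limit `L` along a filter invariant
under scaling, then `c a² = 1`. -/
theorem mul_sq_eq_one_of_tendsto {ψ : ℝ → ℂ} {a c : ℝ} {L : ℂ} {l : Filter ℝ} [l.NeBot]
    (ha : 0 < a) (hl : Tendsto (fun θ => a * θ) l l) (hne : ∀ᶠ θ in l, θ ≠ 0)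
    (hL : L ≠ 0) (hlim : Tendsto (fun θ : ℝ => ψ θ / (θ : ℂ) ^ 2) l (𝓝 L))
    (hψ : ∀ θ, ψ θ = c * ψ (a * θ)) : c * a ^ 2 = 1 := by
  have h1 : Tendsto (fun θ : ℝ => ((c * a ^ 2 : ℝ) : ℂ) *
      (ψ (a * θ) / ((a * θ : ℝ) : ℂ) ^ 2)) l (𝓝 (((c * a ^ 2 : ℝ) : ℂ) * L)) :=
    (hlim.comp hl).const_mul _
  have h2 : (fun θ : ℝ => ((c * a ^ 2 : ℝ) : ℂ) * (ψ (a * θ) / ((a * θ : ℝ) : ℂ) ^ 2))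
      =ᶠ[l] fun θ : ℝ => ψ θ / (θ : ℂ) ^ 2 := by
    filter_upwards [hne] with θ hθ
    have haC : (a : ℂ) ≠ 0 := by exact_mod_cast ha.ne'
    have hθC : (θ : ℂ) ≠ 0 := by exact_mod_cast hθ
    rw [hψ θ]
    push_cast
    field_simp
  have h3 := tendsto_nhds_unique (h1.congr' h2) hlim
  have h4 := mul_right_cancel₀ hL (h3.trans (one_mul L).symm)
  exact_mod_cast h4

theorem tendsto_const_mul_nhdsNE_zero {a : ℝ} (ha : 0 < a) :
    Tendsto (fun θ : ℝ => a * θ) (𝓝[≠] 0) (𝓝[≠] 0) := by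
  refine tendsto_nhdsWithin_iff.2 ⟨?_, ?_⟩
  · have : Tendsto (fun θ : ℝ => a * θ) (𝓝 0) (𝓝 (a * 0)) := tendsto_id.const_mul a
    rw [mul_zero] at this
    exact this.mono_left nhdsWithin_le_nhds
  · filter_upwards [self_mem_nhdsWithin] with θ hθ
    exact mul_ne_zero ha.ne' hθ

theorem tendsto_const_mul_cobounded {a : ℝ} (ha : 0 < a) :
    Tendsto (fun θ : ℝ => a * θ) (Bornology.cobounded ℝ) (Bornology.cobounded ℝ) := by
  rw [← tendsto_norm_atTop_iff_cobounded]
  simp only [norm_mul, Real.norm_of_nonneg ha.le]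
  exact tendsto_norm_cobounded_atTop.const_mul_atTop ha

theorem IsCharExponent.eq_gaussianReal {μ : Measure ℝ} [IsFiniteMeasure μ] {ψ : ℝ → ℂ}
    (hψ : IsCharExponent μ ψ) {v : ℝ} (hv : 0 ≤ v)
    (h : ∀ θ : ℝ, θ ≠ 0 → ψ θ / (θ : ℂ) ^ 2 = (v / 2 : ℝ)) : μ = gaussianReal 0 v.toNNReal := by
  refine Measure.ext_of_charFun (funext fun θ => ?_)
  rw [hψ.charFun_eq, charFun_gaussianReal, Real.coe_toNNReal v hv]
  congr 1
  rcases eq_or_ne θ 0 with rfl | hθ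
  · simp [hψ.map_zero]
  have hθC : (θ : ℂ) ≠ 0 := by exact_mod_cast hθ
  have := h θ hθ
  rw [div_eq_iff (by positivity)] at this
  rw [this]
  push_cast
  simp
  ring

end Rigidity

/-! ### Gaussian component: behaviour of the exponent at infinity -/

section GaussianComponent

theorem norm_exp_mul_I_sub_one_sub_le (y : ℝ) :
    ‖Complex.exp (Complex.I * y) - 1 - Complex.I * y‖ ≤ 3 * y ^ 2 := by
  have hn : ‖Complex.I * (y : ℂ)‖ = |y| := by simp
  rcases le_or_gt |y| 1 with h | h
  · have := Complex.norm_exp_sub_one_sub_id_le (x := Complex.I * y) (by rw [hn]; exact h)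
    rw [hn, sq_abs] at this
    nlinarith [sq_nonneg y]
  · have h1 : ‖Complex.exp (Complex.I * y)‖ = 1 := by
      rw [mul_comm]; exact Complex.norm_exp_ofReal_mul_I y
    calc _ ≤ ‖Complex.exp (Complex.I * y)‖ + ‖(1 : ℂ)‖ + ‖Complex.I * (y : ℂ)‖ :=
          (norm_sub_le _ _).trans (by gcongr; exact norm_sub_le _ _)
      _ = 2 + |y| := by rw [h1, hn, norm_one]; norm_num
      _ ≤ 3 * y ^ 2 := by nlinarith [sq_abs y]

/-- The integrand of the Lévy--Khintchine formula. -/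
noncomputable def levyIntegrand (θ x : ℝ) : ℂ :=
  1 - Complex.exp (Complex.I * θ * x) + Complex.I * θ * x / (1 + x ^ 2)

theorem one_add_sq_ne_zero (x : ℝ) : (1 + (x : ℂ) ^ 2) ≠ 0 := by
  have : (1 + x ^ 2 : ℝ) ≠ 0 := by positivity
  exact_mod_cast this

theorem norm_one_sub_exp_le (θ x : ℝ) : ‖1 - Complex.exp (Complex.I * θ * x)‖ ≤ 2 := by
  have h1 : ‖Complex.exp (Complex.I * θ * x)‖ = 1 := by
    have := Complex.norm_exp_ofReal_mul_I (θ * x)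
    rw [← this]; push_cast; ring_nf
  refine (norm_sub_le _ _).trans ?_
  rw [h1, norm_one]; norm_num

theorem norm_compensator (θ x : ℝ) :
    ‖Complex.I * θ * x / (1 + (x : ℂ) ^ 2)‖ = |θ| * |x| / (1 + x ^ 2) := by
  have : (1 + (x : ℂ) ^ 2) = ((1 + x ^ 2 : ℝ) : ℂ) := by push_cast; ring
  rw [this, norm_div, Complex.norm_real, Real.norm_of_nonneg (by positivity)]
  simp

theorem norm_levyIntegrand_le_add (θ x : ℝ) : ‖levyIntegrand θ x‖ ≤ 2 + |θ| := by
  refine (norm_add_le _ _).trans (add_le_add (norm_one_sub_exp_le θ x) ?_)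
  rw [norm_compensator, div_le_iff₀ (by positivity)]
  gcongr
  nlinarith [sq_abs x, sq_nonneg (|x| - 1), abs_nonneg x]

theorem norm_levyIntegrand_le (θ x : ℝ) :
    ‖levyIntegrand θ x‖ ≤ 4 * (1 + θ ^ 2) * min 1 (x ^ 2) := by
  have hθ : |θ| ≤ 1 + θ ^ 2 := by nlinarith [sq_abs θ, sq_nonneg (|θ| - 1), abs_nonneg θ]
  rcases le_total (x ^ 2) 1 with h | h
  · rw [min_eq_right h]
    -- Writing `1 / (1 + x²) = 1 - x² / (1 + x²)` in the compensator leaves a second order Taylor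
    -- remainder, at most `3 θ² x²`, and a term at most `|θ| x²`.
    have e : levyIntegrand θ x =
        -(Complex.exp (Complex.I * (θ * x : ℝ)) - 1 - Complex.I * (θ * x : ℝ)) -
          (x ^ 2 : ℝ) * (Complex.I * θ * x / (1 + (x : ℂ) ^ 2)) := by
      have := one_add_sq_ne_zero x
      unfold levyIntegrand
      push_cast
      rw [mul_assoc Complex.I]
      field_simp
      ring
    rw [e]
    refine (norm_sub_le _ _).trans ?_
    rw [norm_neg, norm_mul, norm_compensator, Complex.norm_real,
      Real.norm_of_nonneg (sq_nonneg x)]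
    have h1 := norm_exp_mul_I_sub_one_sub_le (θ * x)
    have h2 : |θ| * |x| / (1 + x ^ 2) ≤ |θ| := by
      rw [div_le_iff₀ (by positivity)]
      gcongr
      nlinarith [sq_abs x, sq_nonneg (|x| - 1), abs_nonneg x]
    nlinarith [mul_le_mul_of_nonneg_left (h2.trans hθ) (sq_nonneg x), sq_nonneg x]
  · rw [min_eq_left h]
    have := norm_levyIntegrand_le_add θ x
    nlinarith [sq_nonneg θ]

variable {ν : Measure ℝ}

theorem integrable_min_one_sq (hν : ∫⁻ x, ENNReal.ofReal (min 1 (x ^ 2)) ∂ν < ∞) :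
    Integrable (fun x : ℝ => min 1 (x ^ 2)) ν := by
  refine ⟨(by fun_prop : Continuous fun x : ℝ => min 1 (x ^ 2)).aestronglyMeasurable, ?_⟩
  rwa [hasFiniteIntegral_iff_ofReal (Eventually.of_forall fun x => by positivity)]

theorem continuous_levyIntegrand_left (x : ℝ) : Continuous fun θ => levyIntegrand θ x := by
  unfold levyIntegrand; fun_prop

theorem continuous_levyIntegrand (θ : ℝ) : Continuous (levyIntegrand θ) := by
  have := one_add_sq_ne_zero
  unfold levyIntegrand
  fun_prop (disch := assumption)

theorem continuous_integral_levyIntegrand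
    (hν : ∫⁻ x, ENNReal.ofReal (min 1 (x ^ 2)) ∂ν < ∞) :
    Continuous fun θ => ∫ x, levyIntegrand θ x ∂ν := by
  refine continuous_iff_continuousAt.2 fun θ₀ => ?_
  refine continuousAt_of_dominated (bound := fun x => 4 * (1 + (|θ₀| + 1) ^ 2) * min 1 (x ^ 2))
    (Eventually.of_forall fun θ => (continuous_levyIntegrand θ).aestronglyMeasurable) ?_
    ((integrable_min_one_sq hν).const_mul _)
    (Eventually.of_forall fun x => (continuous_levyIntegrand_left x).continuousAt)
  have : ∀ᶠ θ in 𝓝 θ₀, |θ| < |θ₀| + 1 :=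
    continuous_abs.continuousAt.eventually_lt_const (by linarith)
  filter_upwards [this] with θ hθ
  refine Eventually.of_forall fun x => (norm_levyIntegrand_le θ x).trans ?_
  have h0 : 0 ≤ min 1 (x ^ 2) := by positivity
  rw [← sq_abs θ]
  gcongr

theorem eventually_one_le_abs_cobounded : ∀ᶠ θ : ℝ in Bornology.cobounded ℝ, 1 ≤ |θ| :=
  tendsto_norm_cobounded_atTop.eventually_ge_atTop 1

theorem eventually_ne_zero_cobounded : ∀ᶠ θ : ℝ in Bornology.cobounded ℝ, θ ≠ 0 :=
  eventually_one_le_abs_cobounded.mono fun θ h h0 => by simp [h0] at h; linarith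

theorem tendsto_inv_abs_cobounded :
    Tendsto (fun θ : ℝ => |θ|⁻¹) (Bornology.cobounded ℝ) (𝓝 0) :=
  tendsto_inv_atTop_zero.comp tendsto_norm_cobounded_atTop

/-- Dominated convergence: for fixed `x` the integrand grows at most linearly in `θ`, while `4 (1 +
θ²) / θ² ≤ 8` for `|θ| ≥ 1` provides the dominating function. -/
theorem tendsto_integral_levyIntegrand_div_sq
    (hν : ∫⁻ x, ENNReal.ofReal (min 1 (x ^ 2)) ∂ν < ∞) :
    Tendsto (fun θ : ℝ => (∫ x, levyIntegrand θ x ∂ν) / (θ : ℂ) ^ 2) (Bornology.cobounded ℝ)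
      (𝓝 0) := by
  have : IsCountablyGenerated (Bornology.cobounded ℝ) := by
    rw [← comap_norm_atTop]; infer_instance
  have h := tendsto_integral_filter_of_dominated_convergence (μ := ν)
    (l := Bornology.cobounded ℝ) (F := fun θ x => levyIntegrand θ x / (θ : ℂ) ^ 2)
    (f := fun _ => 0) (fun x => 8 * min 1 (x ^ 2))
    (Eventually.of_forall fun θ =>
      ((continuous_levyIntegrand θ).div_const _).aestronglyMeasurable) ?_
    ((integrable_min_one_sq hν).const_mul _) (Eventually.of_forall fun x => ?_)
  · simpa only [integral_div, integral_zero] using h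
  · filter_upwards [eventually_one_le_abs_cobounded] with θ hθ
    refine Eventually.of_forall fun x => ?_
    have hθ2 : 1 ≤ θ ^ 2 := by rw [← sq_abs]; nlinarith
    have h0 : 0 ≤ min 1 (x ^ 2) := by positivity
    rw [norm_div, norm_pow, Complex.norm_real, Real.norm_eq_abs, sq_abs,
      div_le_iff₀ (by positivity)]
    nlinarith [norm_levyIntegrand_le θ x]
  · have hb : Tendsto (fun θ : ℝ => 2 * |θ|⁻¹ ^ 2 + |θ|⁻¹) (Bornology.cobounded ℝ) (𝓝 0) := by
      simpa using ((tendsto_inv_abs_cobounded.pow 2).const_mul 2).add tendsto_inv_abs_cobounded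
    refine squeeze_zero_norm' ?_ hb
    filter_upwards [eventually_ne_zero_cobounded] with θ hθ
    have hθ' : 0 < |θ| := abs_pos.2 hθ
    rw [norm_div, norm_pow, Complex.norm_real, Real.norm_eq_abs, div_le_iff₀ (by positivity)]
    refine (norm_levyIntegrand_le_add θ x).trans (le_of_eq ?_)
    field_simp

theorem IsLevyKhintchineTriplet.isCharExponent {μ : Measure ℝ} {a σ : ℝ}
    (h : IsLevyKhintchineTriplet μ a σ ν) :
    IsCharExponent μ (fun θ : ℝ => Complex.I * a * θ + (1 / 2 : ℂ) * σ ^ 2 * θ ^ 2 +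
      ∫ x, levyIntegrand θ x ∂ν) where
  continuous := by
    have := continuous_integral_levyIntegrand h.lintegral_lt_top
    fun_prop
  map_zero := by simp [levyIntegrand]
  charFun_eq := h.charFun_eq

/-- Drift and jump integral are both `o(θ²)` at infinity, so only the Gaussian term survives. -/
theorem IsLevyKhintchineTriplet.tendsto_div_sq {μ : Measure ℝ} {a σ : ℝ}
    (h : IsLevyKhintchineTriplet μ a σ ν) {ψ : ℝ → ℂ} (hψ : IsCharExponent μ ψ) :
    Tendsto (fun θ : ℝ => ψ θ / (θ : ℂ) ^ 2) (Bornology.cobounded ℝ)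
      (𝓝 ((σ ^ 2 / 2 : ℝ) : ℂ)) := by
  rw [hψ.unique h.isCharExponent]
  have h1 : Tendsto (fun θ : ℝ => Complex.I * a * (θ : ℂ)⁻¹) (Bornology.cobounded ℝ) (𝓝 0) := by
    refine squeeze_zero_norm (a := fun θ : ℝ => |a| * |θ|⁻¹) (fun θ => by simp) ?_
    simpa using tendsto_inv_abs_cobounded.const_mul |a|
  have h2 := (h1.add_const ((σ ^ 2 / 2 : ℝ) : ℂ)).add
    (tendsto_integral_levyIntegrand_div_sq h.lintegral_lt_top)
  rw [zero_add, add_zero] at h2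
  refine h2.congr' ?_
  filter_upwards [eventually_ne_zero_cobounded] with θ hθ
  have hθC : (θ : ℂ) ≠ 0 := by exact_mod_cast hθ
  push_cast
  field_simp

/-- The characteristic exponent of a non-Gaussian law with a Gaussian component is rigid. -/
theorem isScaleRigid_of_hasGaussianComponent {μ : Measure ℝ} [IsFiniteMeasure μ] {ψ : ℝ → ℂ}
    (hψ : IsCharExponent μ ψ) (hG : HasGaussianComponent μ)
    (hn : ∀ v, μ ≠ gaussianReal 0 v) : IsScaleRigid ψ := by
  obtain ⟨b, σ, ν, hT, hσ⟩ := hG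
  intro a c ha hc he
  have hlim := hT.tendsto_div_sq hψ
  have hL : ((σ ^ 2 / 2 : ℝ) : ℂ) ≠ 0 := by
    have : σ ^ 2 / 2 ≠ 0 := by positivity
    exact_mod_cast this
  have hca := mul_sq_eq_one_of_tendsto ha (tendsto_const_mul_cobounded ha)
    eventually_ne_zero_cobounded hL hlim he
  have ha1 : a = 1 := by
    by_contra ha1
    refine hn _ (hψ.eq_gaussianReal (sq_nonneg σ) fun θ hθ => ?_)
    exact eq_of_scale_invariant_of_tendsto_cobounded (h := fun θ : ℝ => ψ θ / (θ : ℂ) ^ 2) ha ha1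
      (div_sq_scale_invariant ha hca he) hlim hθ
  subst ha1
  exact ⟨rfl, by simpa using hca⟩

end GaussianComponent

/-! ### Finite variance: behaviour of the exponent at zero -/

section SecondMoment

variable {Ω : Type*} [MeasurableSpace Ω] {P : Measure Ω}

/-- Second order behaviour at `0` of the characteristic exponent of a centred variable. -/
theorem IsCharExponent.tendsto_div_sq_of_centred [IsProbabilityMeasure P] {Y : Ω → ℝ} (hm : AEMeasurable Y P)
    (hY : MemLp Y 2 P) (h0 : ∫ ω, Y ω ∂P = 0) {ψ : ℝ → ℂ} (hψ : IsCharExponent (P.map Y) ψ) :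
    Tendsto (fun θ : ℝ => ψ θ / (θ : ℂ) ^ 2) (𝓝[≠] 0)
      (𝓝 (((∫ ω, Y ω ^ 2 ∂P) / 2 : ℝ) : ℂ)) := by
  have : IsProbabilityMeasure (P.map Y) := Measure.isProbabilityMeasure_map hm
  have hid : MemLp id 2 (P.map Y) := (memLp_map_measure_iff (by fun_prop) hm).2 hY
  have hT : (fun t : ℝ => charFun (P.map Y) t - (1 - ((∫ ω, Y ω ^ 2 ∂P : ℝ) : ℂ) * t ^ 2 / 2))
      =o[𝓝 0] fun t : ℝ => t ^ 2 := by
    have := taylor_isLittleO_univ (n := 2) (x₀ := (0 : ℝ)) (contDiff_charFun (n := 2) hid)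
    simp only [taylorWithinEval_charFun_two_zero hm hid, h0, sub_zero] at this
    simpa using this
  have h1 : Tendsto (fun t : ℝ => (charFun (P.map Y) t - 1) / (t : ℂ) ^ 2) (𝓝[≠] 0)
      (𝓝 (-((∫ ω, Y ω ^ 2 ∂P : ℝ) : ℂ) / 2)) := by
    have hT' : (fun t : ℝ => charFun (P.map Y) t -
        (1 - ((∫ ω, Y ω ^ 2 ∂P : ℝ) : ℂ) * t ^ 2 / 2)) =o[𝓝[≠] 0] fun t : ℝ => (t : ℂ) ^ 2 := by
      refine (hT.mono nhdsWithin_le_nhds).trans_isBigO (IsBigO.of_bound 1 ?_)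
      exact Eventually.of_forall fun t => by simp
    have := hT'.tendsto_div_nhds_zero.add_const (-((∫ ω, Y ω ^ 2 ∂P : ℝ) : ℂ) / 2)
    rw [zero_add] at this
    refine this.congr' ?_
    filter_upwards [self_mem_nhdsWithin] with t ht
    have htC : (t : ℂ) ≠ 0 := by exact_mod_cast ht
    field_simp
    ring
  -- As `ψ` vanishes at `0`, this equivalence carries the second order expansion from the
  -- characteristic function to `-ψ` without a logarithm.
  have hexp : (fun w : ℂ => Complex.exp w - 1) ~[𝓝 0] fun w => w := by
    have := (hasDerivAt_iff_isLittleO.1 (Complex.hasDerivAt_exp 0))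
    simpa [IsEquivalent, Pi.sub_def] using this
  have hψ0 : Tendsto (fun t => -ψ t) (𝓝[≠] 0) (𝓝 0) := by
    have := (hψ.continuous.tendsto 0).neg
    rw [hψ.map_zero, neg_zero] at this
    exact this.mono_left nhdsWithin_le_nhds
  have h2 : (fun t : ℝ => charFun (P.map Y) t - 1) ~[𝓝[≠] 0] fun t => -ψ t := by
    have := hexp.comp_tendsto hψ0
    simpa only [Function.comp_def, ← hψ.charFun_eq] using this
  have h3 := (h2.div (IsEquivalent.refl (u := fun t : ℝ => (t : ℂ) ^ 2))).tendsto_nhds h1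
  convert h3.neg using 2
  · simp [neg_div]
  · push_cast; ring_nf

/-- The exponent of a centred variable, in terms of that of the variable. -/
theorem IsCharExponent.sub_const {Y : Ω → ℝ} (hm : Measurable Y) {ψ : ℝ → ℂ}
    (hψ : IsCharExponent (P.map Y) ψ) (m : ℝ) :
    IsCharExponent (P.map fun ω => Y ω - m) fun θ => ψ θ + Complex.I * m * θ where
  continuous := by
    have := hψ.continuous
    fun_prop
  map_zero := by simp [hψ.map_zero]
  charFun_eq θ := by
    have h := hψ.charFun_eq θ
    rw [charFun_apply_real, integral_map hm.aemeasurable (by fun_prop)] at h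
    rw [charFun_apply_real, integral_map (by fun_prop) (by fun_prop), neg_add, Complex.exp_add,
      ← h, ← integral_mul_const]
    congr 1
    ext ω
    rw [← Complex.exp_add]
    congr 1
    push_cast
    ring

/-- The characteristic exponent of a non-degenerate square integrable variable which has nonzero
mean or is not Gaussian is rigid. -/
theorem isScaleRigid_of_memLp_two [IsProbabilityMeasure P] {Y : Ω → ℝ} (hm : Measurable Y) (hY : MemLp Y 2 P)
    (hV : 0 < Var[Y; P]) (h : ∫ ω, Y ω ∂P ≠ 0 ∨ ∀ v, P.map Y ≠ gaussianReal 0 v) {ψ : ℝ → ℂ}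
    (hψ : IsCharExponent (P.map Y) ψ) : IsScaleRigid ψ := by
  set m := ∫ ω, Y ω ∂P with hmdef
  set V := Var[Y; P] with hVdef
  have : IsProbabilityMeasure (P.map Y) := Measure.isProbabilityMeasure_map hm.aemeasurable
  have hint : Integrable Y P := hY.integrable (by norm_num)
  have hlim : Tendsto (fun θ : ℝ => (ψ θ + Complex.I * m * θ) / (θ : ℂ) ^ 2) (𝓝[≠] 0)
      (𝓝 ((V / 2 : ℝ) : ℂ)) := by
    have := IsCharExponent.tendsto_div_sq_of_centred (Y := fun ω => Y ω - m)
      (by fun_prop) (hY.sub (memLp_const m)) (by rw [integral_sub hint (integrable_const _)]; simp [hmdef])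
      (hψ.sub_const hm m)
    rwa [← variance_eq_integral hm.aemeasurable] at this
  have hlim1 : Tendsto (fun θ : ℝ => ψ θ / (θ : ℂ)) (𝓝[≠] 0) (𝓝 (-(Complex.I * m))) := by
    have hid : Tendsto (fun θ : ℝ => (θ : ℂ)) (𝓝[≠] 0) (𝓝 0) := by
      have := Complex.continuous_ofReal.tendsto 0
      exact this.mono_left nhdsWithin_le_nhds
    have := (hlim.mul hid).sub_const (Complex.I * m)
    rw [mul_zero, zero_sub] at this
    refine this.congr' ?_
    filter_upwards [self_mem_nhdsWithin] with θ hθ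
    have hθC : (θ : ℂ) ≠ 0 := by exact_mod_cast hθ
    field_simp
    ring
  -- The mean enters only through the purely imaginary term `i m θ`; real parts remove it, and since
  -- `c` is real they obey the same scaling relation.
  have hre : Tendsto (fun θ : ℝ => ((ψ θ).re : ℂ) / (θ : ℂ) ^ 2) (𝓝[≠] 0)
      (𝓝 ((V / 2 : ℝ) : ℂ)) := by
    have h1 := (Complex.continuous_ofReal.comp Complex.continuous_re).tendsto _ |>.comp hlim
    simp only [Function.comp_def, Complex.ofReal_re] at h1
    refine h1.congr fun θ => ?_
    rw [← Complex.ofReal_pow, Complex.div_ofReal_re]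
    simp
  have hVL : ((V / 2 : ℝ) : ℂ) ≠ 0 := by
    have : V / 2 ≠ 0 := by positivity
    exact_mod_cast this
  intro a c ha hc he
  have hca : c * a ^ 2 = 1 :=
    mul_sq_eq_one_of_tendsto (ψ := fun θ => ((ψ θ).re : ℂ)) ha (tendsto_const_mul_nhdsNE_zero ha)
      self_mem_nhdsWithin hVL hre fun θ => by
        conv_lhs => rw [he θ, Complex.re_ofReal_mul]
        push_cast
        rfl
  have ha1 : a = 1 := by
    -- For `m = 0` the quotient `ψ θ / θ²` itself has a limit, and `a ≠ 1` would make the law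
    -- centred Gaussian. For `m ≠ 0` comparing the limits of `ψ θ / θ` gives `c a = 1`.
    by_cases hm0 : m = 0
    · by_contra ha1
      have hn := h.resolve_left (not_not.2 hm0)
      refine hn _ (hψ.eq_gaussianReal hV.le fun θ hθ => ?_)
      refine eq_of_scale_invariant_of_tendsto_zero (h := fun θ : ℝ => ψ θ / (θ : ℂ) ^ 2) ha ha1
        (div_sq_scale_invariant ha hca he) ?_ hθ
      simpa [hm0] using hlim
    · have h1 : Tendsto (fun θ : ℝ => ((c * a : ℝ) : ℂ) * (ψ (a * θ) / ((a * θ : ℝ) : ℂ)))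
          (𝓝[≠] 0) (𝓝 (((c * a : ℝ) : ℂ) * -(Complex.I * m))) :=
        (hlim1.comp (tendsto_const_mul_nhdsNE_zero ha)).const_mul _
      have h2 : (fun θ : ℝ => ((c * a : ℝ) : ℂ) * (ψ (a * θ) / ((a * θ : ℝ) : ℂ)))
          =ᶠ[𝓝[≠] 0] fun θ : ℝ => ψ θ / (θ : ℂ) := by
        filter_upwards [self_mem_nhdsWithin] with θ hθ
        have haC : (a : ℂ) ≠ 0 := by exact_mod_cast ha.ne'
        have hθC : (θ : ℂ) ≠ 0 := by exact_mod_cast hθ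
        rw [he θ]
        push_cast
        field_simp
      have h3 := tendsto_nhds_unique (h1.congr' h2) hlim1
      have hne : -(Complex.I * (m : ℂ)) ≠ 0 := by simpa using hm0
      have h4 : ((c * a : ℝ) : ℂ) = 1 := mul_right_cancel₀ hne (h3.trans (one_mul _).symm)
      have h5 : c * a = 1 := by exact_mod_cast h4
      calc a = (c * a) * a := by rw [h5, one_mul]
        _ = 1 := by rw [← hca]; ring
  subst ha1
  exact ⟨rfl, by simpa using hca⟩

end SecondMoment

/-! ### From rigid marginals to scaling functions -/

section Processes

variable {Ω : Type*} [MeasurableSpace Ω] {P : Measure Ω} {𝕋 : Set ℝ} {X : ℝ → Ω → ℝ}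
  {f g f' g' : ℝ → ℝ}

theorem IsTimeSet.mul_mem (h : IsTimeSet 𝕋) {T t : ℝ} (hT : 0 < T) (ht : t ∈ 𝕋) : T * t ∈ 𝕋 := by
  rcases h with rfl | rfl | rfl
  · trivial
  · exact mul_nonneg hT.le ht
  · exact mul_pos hT ht

theorem IsTimeSet.one_mem (h : IsTimeSet 𝕋) : (1 : ℝ) ∈ 𝕋 := by
  rcases h with rfl | rfl | rfl <;> simp

/-- The characteristic exponent of a one-dimensional marginal, from the one on `ℝ^1`. -/
theorem isCharExponent_map_of_finDimLaw {t : ℝ} (hm : Measurable (X t))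
    {Ψ : EuclideanSpace ℝ (Fin 1) → ℂ} (hΨ : IsCharExponent (finDimLaw P X fun _ : Fin 1 => t) Ψ) :
    IsCharExponent (P.map (X t)) fun θ => Ψ (WithLp.toLp 2 fun _ => θ) where
  continuous := by
    have := hΨ.continuous
    fun_prop
  map_zero := hΨ.map_zero
  charFun_eq θ := by
    rw [← hΨ.charFun_eq, finDimLaw, charFun_apply_real, charFun_apply,
      integral_map hm.aemeasurable (by fun_prop), integral_map (by fun_prop) (by fun_prop)]
    simp [PiLp.inner_apply]

theorem IsDilativelyStable.isCharExponent_finDimLaw (hX : IsDilativelyStable P 𝕋 X f g) {t : ℝ}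
    (ht : t ∈ 𝕋) : IsCharExponent (finDimLaw P X fun _ : Fin 1 => t)
      (charExponent (finDimLaw P X fun _ : Fin 1 => t)) :=
  (hX.infinitelyDivisible 1 _ fun _ => ht).isCharExponent_charExponent

theorem IsDilativelyStable.isCharExponent_map (hX : IsDilativelyStable P 𝕋 X f g) {t : ℝ}
    (ht : t ∈ 𝕋) : IsCharExponent (P.map (X t)) (charExponent (P.map (X t))) := by
  have h := isCharExponent_map_of_finDimLaw (hX.measurable t ht) (hX.isCharExponent_finDimLaw ht)
  rwa [h.charExponent_eq]

theorem IsDilativelyStable.scaling_map (hX : IsDilativelyStable P 𝕋 X f g) (h𝕋 : IsTimeSet 𝕋)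
    {T t : ℝ} (hT : 0 < T) (ht : t ∈ 𝕋) (θ : ℝ) :
    charExponent (P.map (X (T * t))) θ = g T * charExponent (P.map (X t)) (f T * θ) := by
  have hTt := h𝕋.mul_mem hT ht
  rw [(isCharExponent_map_of_finDimLaw (hX.measurable t ht)
      (hX.isCharExponent_finDimLaw ht)).charExponent_eq,
    (isCharExponent_map_of_finDimLaw (hX.measurable _ hTt)
      (hX.isCharExponent_finDimLaw hTt)).charExponent_eq]
  exact hX.scaling T hT 1 (fun _ => t) (fun _ => ht) _

/-- Both sides are the exponent of the marginal at time `S * T * t`, reached by one dilation or by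
two. -/
theorem IsDilativelyStable.scaling_map_mul (hX : IsDilativelyStable P 𝕋 X f g)
    (h𝕋 : IsTimeSet 𝕋) {S T t : ℝ} (hS : 0 < S) (hT : 0 < T) (ht : t ∈ 𝕋) (θ : ℝ) :
    (g (S * T) : ℂ) * charExponent (P.map (X t)) (f (S * T) * θ) =
      (g S * g T : ℝ) * charExponent (P.map (X t)) (f S * f T * θ) := by
  rw [← hX.scaling_map h𝕋 (mul_pos hS hT) ht, mul_assoc, hX.scaling_map h𝕋 hS (h𝕋.mul_mem hT ht),
    hX.scaling_map h𝕋 hT ht]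
  push_cast
  ring_nf

theorem IsDilativelyStable.exists_charExponent_ne_zero [IsProbabilityMeasure P]
    (hX : IsDilativelyStable P 𝕋 X f g) (hne : ¬ ∀ t ∈ 𝕋, ∀ᵐ ω ∂P, X t ω = 0) :
    ∃ t ∈ 𝕋, ∃ θ, charExponent (P.map (X t)) θ ≠ 0 := by
  -- If every marginal exponent vanished identically, every characteristic function would be `1` and
  -- every marginal law the Dirac mass at `0`.
  by_contra! hcon
  refine hne fun t ht => ?_
  have hm := hX.measurable t ht
  have : IsProbabilityMeasure (P.map (X t)) := Measure.isProbabilityMeasure_map hm.aemeasurable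
  have h : P.map (X t) = Measure.dirac 0 := by
    refine Measure.ext_of_charFun (funext fun θ => ?_)
    rw [(hX.isCharExponent_map ht).charFun_eq, hcon t ht θ]
    simp
  have h0 : ∀ᵐ x ∂(P.map (X t)), x = 0 := by rw [h]; simp [ae_dirac_eq]
  exact ae_of_ae_map hm.aemeasurable h0

/-- If one marginal at a time of `𝕋` has a rigid exponent, then the scaling functions are powers
with unique exponents. -/
theorem IsDilativelyStable.areUniquePowers_of_isScaleRigid (hX : IsDilativelyStable P 𝕋 X f g)
    (h𝕋 : IsTimeSet 𝕋) {t : ℝ} (ht : t ∈ 𝕋) (hR : IsScaleRigid (charExponent (P.map (X t)))) :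
    AreUniquePowers P 𝕋 X f g := by
  have hmul : ∀ S T, 0 < S → 0 < T → f (S * T) = f S * f T ∧ g (S * T) = g S * g T :=
    fun S T hS hT => hR.eq_and_eq (hX.pos_left _ (mul_pos hS hT))
      (mul_pos (hX.pos_left S hS) (hX.pos_left T hT)) (hX.pos_right _ (mul_pos hS hT))
      (mul_pos (hX.pos_right S hS) (hX.pos_right T hT)) (hX.scaling_map_mul h𝕋 hS hT ht)
  obtain ⟨β, hβ⟩ := exists_rpow_of_multiplicative hX.continuousOn_left hX.pos_left
    fun S T hS hT => (hmul S T hS hT).1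
  obtain ⟨γ, hγ⟩ := exists_rpow_of_multiplicative hX.continuousOn_right hX.pos_right
    fun S T hS hT => (hmul S T hS hT).2
  refine ⟨β, γ, hβ, hγ, fun β' γ' h' => ?_⟩
  have key : ∀ T : ℝ, 0 < T → T ^ β' = f T ∧ T ^ γ' = g T := fun T hT =>
    hR.eq_and_eq (h'.pos_left T hT) (hX.pos_left T hT) (h'.pos_right T hT) (hX.pos_right T hT)
      fun θ => (h'.scaling_map h𝕋 hT ht θ).symm.trans (hX.scaling_map h𝕋 hT ht θ)
  exact ⟨rpow_exponent_unique fun T hT => (key T hT).1.trans (hβ T hT),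
    rpow_exponent_unique fun T hT => (key T hT).2.trans (hγ T hT)⟩

theorem IsDilativelyStable.exists_rpow_right [IsProbabilityMeasure P]
    (hX : IsDilativelyStable P 𝕋 X f g) (h𝕋 : IsTimeSet 𝕋)
    (hne : ¬ ∀ t ∈ 𝕋, ∀ᵐ ω ∂P, X t ω = 0) {β : ℝ} (hf : ∀ T : ℝ, 0 < T → f T = T ^ β) :
    ∃ γ : ℝ, (∀ T : ℝ, 0 < T → g T = T ^ γ) ∧
      ∀ γ' : ℝ, IsDilativelyStable P 𝕋 X (fun T => T ^ β) (fun T => T ^ γ') → γ' = γ := by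
  obtain ⟨t, ht, θ, hθ⟩ := hX.exists_charExponent_ne_zero hne
  have hcancel : ∀ b c c' : ℝ, 0 < b → (∀ θ : ℝ, (c : ℂ) * charExponent (P.map (X t)) (b * θ) =
      c' * charExponent (P.map (X t)) (b * θ)) → c = c' := fun b c c' hb he => by
    -- This choice evaluates the exponent at the point `θ` where it is nonzero.
    have := he (b⁻¹ * θ)
    rw [mul_inv_cancel_left₀ hb.ne'] at this
    exact_mod_cast mul_right_cancel₀ hθ this
  obtain ⟨γ, hγ⟩ := exists_rpow_of_multiplicative hX.continuousOn_right hX.pos_right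
    fun S T hS hT => by
      refine hcancel (f (S * T)) _ _ (hX.pos_left _ (mul_pos hS hT)) fun θ => ?_
      -- Because `f` is a power, `f S * f T = f (S * T)`: both arguments agree and only the factors
      -- `g` are left to compare.
      rw [hX.scaling_map_mul h𝕋 hS hT ht, hf S hS, hf T hT, hf _ (mul_pos hS hT),
        Real.mul_rpow hS.le hT.le]
  refine ⟨γ, hγ, fun γ' h' => rpow_exponent_unique fun T hT => ?_⟩
  rw [← hγ T hT]
  refine hcancel (f T) _ _ (hX.pos_left T hT) fun θ => ?_
  rw [← hX.scaling_map h𝕋 hT ht, hf T hT]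
  exact (h'.scaling_map h𝕋 hT ht θ).symm

end Processes

end DilativeStability

theorem theorem1p6 {Ω : Type*} [MeasurableSpace Ω] (P : Measure Ω) [IsProbabilityMeasure P]
    (𝕋 : Set ℝ) (h𝕋 : IsTimeSet 𝕋) (X : ℝ → Ω → ℝ) (f g : ℝ → ℝ)
    (hX : IsDilativelyStable P 𝕋 X f g) :
    (∀ β : ℝ, (¬ ∀ t ∈ 𝕋, ∀ᵐ ω ∂P, X t ω = 0) → (∀ T : ℝ, 0 < T → f T = T ^ β) →
      ∃ γ : ℝ, (∀ T : ℝ, 0 < T → g T = T ^ γ) ∧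
        ∀ γ' : ℝ, IsDilativelyStable P 𝕋 X (fun T => T ^ β) (fun T => T ^ γ') → γ' = γ) ∧
    (¬ IsGaussianVariable P (X 1) → HasGaussianComponent (P.map (X 1)) →
      AreUniquePowers P 𝕋 X f g) ∧
    (MemLp (X 1) 2 P → ∫ ω, X 1 ω ∂P ≠ 0 → 0 < Var[X 1; P] →
      AreUniquePowers P 𝕋 X f g) ∧
    (¬ IsGaussianVariable P (X 1) → MemLp (X 1) 2 P → 0 < Var[X 1; P] →
      AreUniquePowers P 𝕋 X f g) := by
  have h1 := h𝕋.one_mem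
  have hm := hX.measurable 1 h1
  have hψ := hX.isCharExponent_map h1
  have : IsProbabilityMeasure (P.map (X 1)) := Measure.isProbabilityMeasure_map hm.aemeasurable
  refine ⟨fun β hne hf => hX.exists_rpow_right h𝕋 hne hf, fun hn hG => ?_, fun h2 h0 hV => ?_,
    fun hn h2 hV => ?_⟩
  · exact hX.areUniquePowers_of_isScaleRigid h𝕋 h1
      (isScaleRigid_of_hasGaussianComponent hψ hG fun v hv => hn ⟨0, v, hv⟩)
  · exact hX.areUniquePowers_of_isScaleRigid h𝕋 h1
      (isScaleRigid_of_memLp_two hm h2 hV (Or.inl h0) hψ)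
  · exact hX.areUniquePowers_of_isScaleRigid h𝕋 h1
      (isScaleRigid_of_memLp_two hm h2 hV (Or.inr fun v hv => hn ⟨0, v, hv⟩) hψ)
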